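/- Fix finite sets $I$ of input signals and $O$ of output signals. LTL formulas over $I\cup O$ are built from $\mathit{true}$, signals, $\neg$, $\vee$, $\mathsf X$ and $\mathsf U$, with $\mathsf F\psi=\mathit{true}\,\mathsf U\,\psi$ and $\mathsf G\psi=\neg\mathsf F\neg\psi$; the size $|\varphi|$ is the number of (distinct) subformulas of $\varphi$. A Mealy machine $\mathcal M$ has a finite set $T$ of states, an initial state $t_I$, a transition function $\delta:T\times 2^I\to T$ and an output function $\lambda:T\times 2^I\to 2^O$. It is an implementation of $\varphi$ if, for every input word $\nu_0\nu_1\ldots\in(2^I)^\omega$ and the induced run $t_0=t_I$, $t_{k+1}=\delta(t_k,\nu_k)$, the word $\sigma_k=\nu_k\cup\lambda(t_k,\nu_k)$ $(k\ge 0)$ satisfies $\varphi$; and $\varphi$ is realizable if it has an implementation. A cycle of $\mathcal M$ is a simple cycle of the directed graph on $T$ with edges $\{(t,t')\mid \exists\nu\subseteq I.\ \delta(t,\nu)=t'\}$, that is, a pair $(C,\eta)$ of a non-empty set $C\subseteq T$ and a bijection $\eta:C\to C$ such that $(v,\eta(v))$ is an edge for all $v\in C$, and $\eta^k(v)=v\Leftrightarrow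 |C|$ divides $k$, for all $v\in C$ and $k\in\mathbb N$. **Theorem.** There are LTL specifications $\varphi_n$, $n>1$, each over its own finite sets of input and output signals, with $|\varphi_n|\in\Theta(n)$, such that for every $n>1$: the only temporal operators in $\varphi_n$ are $\mathsf X$, $\mathsf G$ and $\mathsf F$; $\varphi_n$ is realizable; and every implementation of $\varphi_n$ has at least triply exponentially many cycles in $n$, namely at least $2^{2^{2^n}}$. -/

import Mathlib

/-- Formulas of linear-time temporal logic over the atomic propositions `AP`. -/
inductive LTL (AP : Type) : Type where
  | tru : LTL AP
  | atom : AP → LTL AP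
  | not : LTL AP → LTL AP
  | or : LTL AP → LTL AP → LTL AP
  | next : LTL AP → LTL AP
  | untl : LTL AP → LTL AP → LTL AP

namespace LTL

variable {AP : Type}

/-- `F φ`, that is, `true U φ`. -/
def eventually (φ : LTL AP) : LTL AP := untl tru φ

/-- `G φ`, that is, `¬ F ¬ φ`. -/
def globally (φ : LTL AP) : LTL AP := not (eventually (not φ))

/-- `φ.Sat α n` is the satisfaction `α, n ⊨ φ` at position `n` of the infinite word `α`. -/
def Sat (α : ℕ → Set AP) : ℕ → LTL AP → Prop
  | _, tru => True
  | n, atom a => a ∈ α n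
  | n, not φ => ¬ Sat α n φ
  | n, or φ ψ => Sat α n φ ∨ Sat α n ψ
  | n, next φ => Sat α (n + 1) φ
  | n, untl φ ψ => ∃ m, n ≤ m ∧ Sat α m ψ ∧ ∀ i, n ≤ i → i < m → Sat α i φ

/-- The language of a formula: all infinite words over `2^AP` that satisfy it at position `0`. -/
def language (φ : LTL AP) : Set (ℕ → Set AP) := {α | Sat α 0 φ}

/-- The set of subformulas, including the formula itself. -/
def subformulas : LTL AP → Set (LTL AP)
  | tru => {tru}
  | atom a => {atom a}
  | not φ => insert (not φ) (subformulas φ)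
  | or φ ψ => insert (or φ ψ) (subformulas φ ∪ subformulas ψ)
  | next φ => insert (next φ) (subformulas φ)
  | untl φ ψ => insert (untl φ ψ) (subformulas φ ∪ subformulas ψ)

theorem subformulas_finite (φ : LTL AP) : φ.subformulas.Finite := by
  induction φ with
  | tru => exact Set.finite_singleton _
  | atom a => exact Set.finite_singleton _
  | not φ h => exact h.insert _
  | or φ ψ h₁ h₂ => exact (h₁.union h₂).insert _
  | next φ h => exact h.insert _
  | untl φ ψ h₁ h₂ => exact (h₁.union h₂).insert _

/-- The size of a formula: its number of subformulas. -/
noncomputable def size (φ : LTL AP) : ℕ := φ.subformulas.ncard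

/-- The fragment in which the only temporal operators are `X`, `G` and `F`. -/
inductive OnlyXGF : LTL AP → Prop where
  | tru : OnlyXGF tru
  | atom (a : AP) : OnlyXGF (atom a)
  | not {φ : LTL AP} : OnlyXGF φ → OnlyXGF (not φ)
  | or {φ ψ : LTL AP} : OnlyXGF φ → OnlyXGF ψ → OnlyXGF (or φ ψ)
  | next {φ : LTL AP} : OnlyXGF φ → OnlyXGF (next φ)
  | globally {φ : LTL AP} : OnlyXGF φ → OnlyXGF (globally φ)
  | eventually {φ : LTL AP} : OnlyXGF φ → OnlyXGF (eventually φ)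

end LTL

/-- The simple cycles `(C, η)` of the directed graph on `V` with edge relation `E`: `C` is a
non-empty set of vertices and `η` a bijection of `C` that moves along edges and has a single orbit. -/
def simpleCycles {V : Type} (E : V → V → Prop) : Set (Σ C : Set V, Equiv.Perm C) :=
  {c | c.1.Nonempty ∧ (∀ v : c.1, E v (c.2 v)) ∧
    ∀ (v : c.1) (k : ℕ), c.2^[k] v = v ↔ k % c.1.ncard = 0}

/-- Mealy machines over input signals `I` and output signals `O`. -/
structure MealyMachine (I O : Type) where
  State : Type
  finite_state : Finite State
  init : State
  /-- transition function -/
  step : State → Set I → State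
  /-- output function -/
  out : State → Set I → Set O

namespace MealyMachine

variable {I O : Type}

/-- The paths of a Mealy machine. The signals are `I ⊕ O`, so that `Sum.inl ⁻¹' σ` is the input part
and `Sum.inr ⁻¹' σ` the output part of a letter `σ`. -/
def paths (M : MealyMachine I O) : Set (ℕ → M.State × Set (I ⊕ O)) :=
  {p | (p 0).1 = M.init ∧ ∀ n,
    M.step (p n).1 (Sum.inl ⁻¹' (p n).2) = (p (n + 1)).1 ∧
    M.out (p n).1 (Sum.inl ⁻¹' (p n).2) = Sum.inr ⁻¹' (p n).2}

/-- `M` is an implementation of `φ`: the words along all paths of `M` satisfy `φ`. -/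
def Implements (M : MealyMachine I O) (φ : LTL (I ⊕ O)) : Prop :=
  (fun p n => (p n).2) '' M.paths ⊆ φ.language

/-- The state graph, which ignores the input labels. -/
def Edge (M : MealyMachine I O) (t t' : M.State) : Prop := ∃ ν : Set I, M.step t ν = t'

/-- The set of cycles of a Mealy machine. -/
def cycles (M : MealyMachine I O) : Set (Σ C : Set M.State, Equiv.Perm C) := simpleCycles M.Edge

theorem cycles_finite (M : MealyMachine I O) : M.cycles.Finite := by
  classical
  have := M.finite_state
  exact Set.toFinite _

end MealyMachine

/-- A specification is realizable if it has an implementation. -/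
def LTL.Realizable {I O : Type} (φ : LTL (I ⊕ O)) : Prop :=
  ∃ M : MealyMachine I O, M.Implements φ

/-! The specification describes a memory with one bit for each of the `2^n` addresses. Every letter
writes a bit at its address, and at the only query the system must say whether the queried address
is stored. Addresses are compared through `F (query ∧ bit)`, which is unambiguous when there is just
one query, so linear size suffices. Since a query might come at any moment, a state reached without
queries determines all `N = 2^(2^n)` possible memory contents (`memory_eq_of_run_eq`). Because of
the echo it also determines the last side bit (`side_iff_of_run_eq`). Now let the inputs write a
cyclic Gray code through all contents, with side bits given by some `β ⊆ Fin N` and the position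
modulo `N`. The resulting walk contains a simple cycle, which must pass through all contents, and
`β` can be read off its states. Different `β` thus give different cycles, `2^N` in all. -/

namespace LTL

variable {AP : Type}

/-- Conjunction. -/
def and (φ ψ : LTL AP) : LTL AP := not (or (not φ) (not ψ))

/-- Implication. -/
def imp (φ ψ : LTL AP) : LTL AP := or (not φ) ψ

/-- Equivalence. -/
def iff (φ ψ : LTL AP) : LTL AP := and (imp φ ψ) (imp ψ φ)

/-- The conjunction of a list of formulas. -/
def conj : List (LTL AP) → LTL AP
  | [] => tru
  | φ :: l => and φ (conj l)

section Sat

variable (α : ℕ → Set AP) (k : ℕ) (φ ψ : LTL AP)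

theorem sat_atom (a : AP) : Sat α k (atom a) ↔ a ∈ α k := Iff.rfl

theorem sat_not : Sat α k (not φ) ↔ ¬ Sat α k φ := Iff.rfl

theorem sat_or : Sat α k (or φ ψ) ↔ Sat α k φ ∨ Sat α k ψ := Iff.rfl

theorem sat_next : Sat α k (next φ) ↔ Sat α (k + 1) φ := Iff.rfl

theorem sat_and : Sat α k (and φ ψ) ↔ Sat α k φ ∧ Sat α k ψ := by
  simp only [and, sat_not, sat_or]; tauto

theorem sat_imp : Sat α k (imp φ ψ) ↔ (Sat α k φ → Sat α k ψ) := by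
  simp only [imp, sat_not, sat_or]; tauto

theorem sat_iff : Sat α k (iff φ ψ) ↔ (Sat α k φ ↔ Sat α k ψ) := by
  simp only [iff, sat_and, sat_imp]; tauto

theorem sat_eventually : Sat α k (eventually φ) ↔ ∃ m, k ≤ m ∧ Sat α m φ := by
  simp [eventually, Sat]

theorem sat_globally : Sat α k (globally φ) ↔ ∀ m, k ≤ m → Sat α m φ := by
  simp only [globally, sat_not, sat_eventually]; push Not; rfl

theorem sat_conj (l : List (LTL AP)) : Sat α k (conj l) ↔ ∀ χ ∈ l, Sat α k χ := by
  induction l with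
  | nil => simp [conj, Sat]
  | cons χ l ih => simp [conj, sat_and, ih]

end Sat

namespace OnlyXGF

variable {φ ψ : LTL AP}

theorem and (h₁ : OnlyXGF φ) (h₂ : OnlyXGF ψ) : OnlyXGF (φ.and ψ) := (h₁.not.or h₂.not).not

theorem imp (h₁ : OnlyXGF φ) (h₂ : OnlyXGF ψ) : OnlyXGF (φ.imp ψ) := h₁.not.or h₂

theorem iff (h₁ : OnlyXGF φ) (h₂ : OnlyXGF ψ) : OnlyXGF (φ.iff ψ) := (h₁.imp h₂).and (h₂.imp h₁)

theorem conj {l : List (LTL AP)} (h : ∀ χ ∈ l, OnlyXGF χ) : OnlyXGF (LTL.conj l) := by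
  induction l with
  | nil => exact .tru
  | cons χ l ih =>
    exact (h χ (by simp)).and (ih fun χ' h' => h χ' (by simp [h']))

end OnlyXGF

/-! ### Bounding the size by the length -/

/-- The number of nodes of the syntax tree. -/
def length : LTL AP → ℕ
  | tru => 1
  | atom _ => 1
  | not φ => φ.length + 1
  | or φ ψ => φ.length + ψ.length + 1
  | next φ => φ.length + 1
  | untl φ ψ => φ.length + ψ.length + 1

theorem size_le_length (φ : LTL AP) : φ.size ≤ φ.length := by
  have unary (χ φ : LTL AP) (h : φ.subformulas.ncard ≤ φ.length) :
      (insert χ φ.subformulas).ncard ≤ φ.length + 1 :=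
    (Set.ncard_insert_le _ _).trans (by omega)
  have binary (χ φ ψ : LTL AP) (h₁ : φ.subformulas.ncard ≤ φ.length)
      (h₂ : ψ.subformulas.ncard ≤ ψ.length) :
      (insert χ (φ.subformulas ∪ ψ.subformulas)).ncard ≤ φ.length + ψ.length + 1 :=
    (Set.ncard_insert_le _ _).trans (by
      have := Set.ncard_union_le φ.subformulas ψ.subformulas
      omega)
  unfold size
  induction φ with
  | tru => simp [subformulas, length]
  | atom a => simp [subformulas, length]
  | not φ h => exact unary _ _ h
  | or φ ψ h₁ h₂ => exact binary _ _ _ h₁ h₂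
  | next φ h => exact unary _ _ h
  | untl φ ψ h₁ h₂ => exact binary _ _ _ h₁ h₂

theorem length_conj_le {l : List (LTL AP)} {c : ℕ} (h : ∀ χ ∈ l, χ.length ≤ c) :
    (conj l).length ≤ (c + 4) * l.length + 1 := by
  induction l with
  | nil => simp [conj, length]
  | cons χ l ih =>
    have h₁ := h χ (by simp)
    have h₂ := ih fun χ' h' => h χ' (by simp [h'])
    simp only [conj, and, length, List.length_cons, mul_add]
    omega

theorem mem_subformulas_conj {l : List (LTL AP)} {χ θ : LTL AP} (h : χ ∈ l)
    (hθ : θ ∈ χ.subformulas) : θ ∈ (conj l).subformulas := by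
  induction l with
  | nil => simp at h
  | cons χ' l ih =>
    rcases List.mem_cons.1 h with rfl | h
    · simp [conj, and, subformulas, hθ]
    · simp [conj, and, subformulas, ih h]

end LTL

/-! ### Runs of Mealy machines -/

namespace MealyMachine

variable {I O : Type} (M : MealyMachine I O)

/-- The state sequence induced by an input word. -/
def run (w : ℕ → Set I) : ℕ → M.State
  | 0 => M.init
  | k + 1 => M.step (run w k) (w k)

/-- The word of input and output signals induced by an input word. -/
def trace (w : ℕ → Set I) (k : ℕ) : Set (I ⊕ O) :=
  Sum.inl '' w k ∪ Sum.inr '' M.out (M.run w k) (w k)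

theorem inl_mem_trace {w : ℕ → Set I} {k : ℕ} {x : I} : Sum.inl x ∈ M.trace w k ↔ x ∈ w k := by
  simp [trace]

theorem inr_mem_trace {w : ℕ → Set I} {k : ℕ} {x : O} :
    Sum.inr x ∈ M.trace w k ↔ x ∈ M.out (M.run w k) (w k) := by
  simp [trace]

theorem run_congr {w w' : ℕ → Set I} {k : ℕ} (h : ∀ j < k, w j = w' j) :
    M.run w k = M.run w' k := by
  induction k with
  | zero => rfl
  | succ k ih => rw [run, run, ih fun j hj => h j (by omega), h k (by omega)]

theorem implements_iff {φ : LTL (I ⊕ O)} :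
    M.Implements φ ↔ ∀ w, (M.trace w) ∈ φ.language := by
  constructor
  · intro h w
    refine h ⟨fun k => (M.run w k, M.trace w k), ⟨rfl, fun k => ?_⟩, rfl⟩
    have h₁ : Sum.inl ⁻¹' M.trace w k = w k := by ext; simp [inl_mem_trace]
    have h₂ : Sum.inr ⁻¹' M.trace w k = M.out (M.run w k) (w k) := by ext; simp [inr_mem_trace]
    simp only [h₁, h₂, and_true]
    rfl
  · rintro h _ ⟨p, ⟨h0, hp⟩, rfl⟩
    let w : ℕ → Set I := fun k => Sum.inl ⁻¹' (p k).2
    have hs : ∀ k, (p k).1 = M.run w k := by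
      intro k
      induction k with
      | zero => exact h0
      | succ k ih => rw [← (hp k).1, ih]; rfl
    convert h w using 1
    funext k
    ext x
    rcases x with x | x
    · simp [inl_mem_trace, w]
    · rw [inr_mem_trace, ← hs, (hp k).2]; rfl

end MealyMachine

/-! ### Simple cycles from walks -/

/-- A walk along edges that returns to its starting vertex after its first `d` distinct vertices
traverses a simple cycle. -/
theorem exists_simpleCycle_of_injOn {V : Type} {E : V → V → Prop} {f : ℕ → V} {i d : ℕ}
    (hE : ∀ k, E (f k) (f (k + 1))) (hd : 0 < d) (hf : f (i + d) = f i)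
    (hinj : Set.InjOn f (Set.Ico i (i + d))) :
    ∃ c ∈ simpleCycles E, c.1 = f '' Set.Ico i (i + d) := by
  have : NeZero d := ⟨hd.ne'⟩
  set C : Set V := f '' Set.Ico i (i + d) with hC
  have hmem (t : ZMod d) : i + t.val ∈ Set.Ico i (i + d) :=
    ⟨by omega, by have := t.val_lt; omega⟩
  -- With the segment indexed by `ZMod d`, the cycle is the rotation `t ↦ t + 1`.
  let e : ZMod d ≃ C := Equiv.ofBijective (fun t => ⟨f (i + t.val), _, hmem t, rfl⟩) (by
    constructor
    · intro s t hst
      have := hinj (hmem s) (hmem t) (congrArg Subtype.val hst)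
      exact ZMod.val_injective d (by omega)
    · rintro ⟨_, k, ⟨hk₁, hk₂⟩, rfl⟩
      refine ⟨((k - i : ℕ) : ZMod d), Subtype.ext ?_⟩
      simp only [ZMod.val_natCast]
      rw [Nat.mod_eq_of_lt (by omega)]
      congr 1
      omega)
  have he (t : ZMod d) : (e t : V) = f (i + t.val) := rfl
  have hcard : C.ncard = d := by
    rw [← Nat.card_coe_set_eq, ← Nat.card_congr e, Nat.card_zmod]
  have hiter (k : ℕ) (t : ZMod d) : (e.permCongr (Equiv.addRight 1))^[k] (e t) = e (t + k) := by
    induction k with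
    | zero => simp
    | succ k ih =>
      rw [Function.iterate_succ_apply', ih]
      simp [Equiv.permCongr_apply, add_assoc]
  refine ⟨⟨C, e.permCongr (Equiv.addRight 1)⟩, ⟨⟨_, (e 0).2⟩, fun v => ?_, fun v k => ?_⟩, rfl⟩
  · obtain ⟨t, rfl⟩ := e.surjective v
    have h : ((e (t + 1) : C) : V) = f (i + t.val + 1) := by
      have ht := t.val_lt
      rw [he, show t + 1 = ((t.val + 1 : ℕ) : ZMod d) by simp, ZMod.val_natCast]
      rcases (Nat.succ_le_of_lt ht).lt_or_eq with hlt | heq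
      · rw [Nat.mod_eq_of_lt hlt, add_assoc]
      · rw [add_assoc, show t.val + 1 = d from heq, Nat.mod_self, hf, add_zero]
    have h' := hiter 1 t
    simp only [Function.iterate_one, Nat.cast_one] at h'
    change E (e t) (e.permCongr (Equiv.addRight 1) (e t) : C)
    rw [h', h, he]
    exact hE _
  · obtain ⟨t, rfl⟩ := e.surjective v
    change (e.permCongr (Equiv.addRight 1))^[k] (e t) = e t ↔ k % C.ncard = 0
    rw [hiter, e.injective.eq_iff, add_eq_left, ZMod.natCast_eq_zero_iff, hcard,
      Nat.dvd_iff_mod_eq_zero]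

/-- Every infinite walk in a finite graph traverses a simple cycle. -/
theorem exists_simpleCycle_of_walk {V : Type} [Finite V] {E : V → V → Prop} {f : ℕ → V}
    (hE : ∀ k, E (f k) (f (k + 1))) :
    ∃ c ∈ simpleCycles E, ∃ i d, 0 < d ∧ f (i + d) = f i ∧ c.1 = f '' Set.Ico i (i + d) := by
  classical
  -- The least return time over all starting points is taken; its minimality makes the segment
  -- injective.
  have hex : ∃ d, 0 < d ∧ ∃ i, f (i + d) = f i := by
    obtain ⟨x, y, hxy, h⟩ := Finite.exists_ne_map_eq_of_infinite f
    rcases hxy.lt_or_gt with hlt | hlt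
    · exact ⟨y - x, by omega, x, by rw [h]; congr 1; omega⟩
    · exact ⟨x - y, by omega, y, by rw [← h]; congr 1; omega⟩
  obtain ⟨hd, i, hi⟩ := Nat.find_spec hex
  have hmin : ∀ x y, x < y → y < x + Nat.find hex → f y ≠ f x := fun x y hxy hlt h =>
    Nat.find_min hex (m := y - x) (by omega) ⟨by omega, x, by rw [← h]; congr 1; omega⟩
  obtain ⟨c, hc, hc'⟩ := exists_simpleCycle_of_injOn (i := i) hE hd hi (by
    rintro x ⟨hx₁, hx₂⟩ y ⟨hy₁, hy₂⟩ h
    rcases lt_trichotomy x y with hlt | rfl | hlt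
    · exact absurd h.symm (hmin x y hlt (by omega))
    · rfl
    · exact absurd h (hmin y x hlt (by omega)))
  exact ⟨c, hc, i, _, hd, hi, hc'⟩

/-! ### Gray codes -/

/-- `X` and `Y` agree at all points but at most one. -/
def DifferAtMostOnce {α : Type} (X Y : Set α) : Prop := ∃ a, ∀ b ≠ a, b ∈ X ↔ b ∈ Y

theorem DifferAtMostOnce.symm {α : Type} {X Y : Set α} (h : DifferAtMostOnce X Y) :
    DifferAtMostOnce Y X :=
  h.imp fun _ h b hb => (h b hb).symm

/-- Reflected Gray code: run through the subsets of `s`, then backwards through the same list with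
`a` added. The last set is `{a}`, so the path closes up to a cycle. -/
theorem exists_gray_path {α : Type} [Nonempty α] (s : Finset α) :
    ∃ h : ℕ → Set α, h 0 = ∅ ∧ (∀ k, h k ⊆ s) ∧ DifferAtMostOnce (h (2 ^ s.card - 1)) ∅ ∧
      Set.InjOn h (Set.Iio (2 ^ s.card)) ∧
      ∀ k, k + 1 < 2 ^ s.card → DifferAtMostOnce (h k) (h (k + 1)) := by
  classical
  induction s using Finset.induction_on with
  | empty =>
    refine ⟨fun _ => ∅, rfl, by simp, ⟨Classical.arbitrary α, by simp⟩, ?_, by simp⟩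
    intro x hx y hy _
    simp at hx hy
    omega
  | insert a s ha ih =>
    obtain ⟨h, h0, hs, -, hinj, hstep⟩ := ih
    have hpos : 0 < 2 ^ s.card := by positivity
    have hna (k : ℕ) : a ∉ h k := fun hk => ha (hs k hk)
    have hins {x y : ℕ} (hxy : insert a (h x) = insert a (h y)) : h x = h y := by
      rw [← Set.insert_sdiff_self_of_notMem (hna x), hxy, Set.insert_sdiff_self_of_notMem (hna y)]
    rw [Finset.card_insert_of_notMem ha, pow_succ]
    set N := 2 ^ s.card
    refine ⟨fun k => if k < N then h k else insert a (h (2 * N - 1 - k)), by simp [hpos, h0],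
      fun k => ?_, ?_, ?_, fun k hk => ?_⟩
    · simp only [Finset.coe_insert]
      split_ifs
      · exact (hs k).trans (Set.subset_insert _ _)
      · exact Set.insert_subset_insert (hs _)
    · refine ⟨a, fun b hb => ?_⟩
      simp [show ¬ N * 2 - 1 < N by omega, show 2 * N - 1 - (N * 2 - 1) = 0 by omega, h0, hb]
    · intro x hx y hy hxy
      simp only [Set.mem_Iio] at hx hy
      simp only at hxy
      split_ifs at hxy with h₁ h₂ h₂
      · exact hinj h₁ h₂ hxy
      · exact absurd (hxy ▸ Set.mem_insert a _) (hna x)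
      · exact absurd (hxy ▸ Set.mem_insert a _) (hna y)
      · have := hinj (show 2 * N - 1 - x ∈ Set.Iio N by simp; omega)
          (show 2 * N - 1 - y ∈ Set.Iio N by simp; omega) (hins hxy)
        omega
    · rcases lt_trichotomy (k + 1) N with hlt | heq | hlt
      · simpa [hlt, show k < N by omega] using hstep k hlt
      · refine ⟨a, fun b hb => ?_⟩
        simp [heq, show k < N by omega, show 2 * N - 1 - N = k by omega, hb]
      · obtain ⟨c, hc⟩ := (hstep (2 * N - 1 - (k + 1)) (by omega)).symm
        refine ⟨c, fun b hb => ?_⟩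
        have := hc b hb
        rw [show 2 * N - 1 - (k + 1) + 1 = 2 * N - 1 - k by omega] at this
        simp [show ¬ k < N by omega, show ¬ k + 1 < N by omega, this]

/-- The cyclic Gray code: a periodic sequence through the subsets of a finite type that changes at
most one point at a time. -/
theorem exists_gray_code (α : Type) [Finite α] [Nonempty α] :
    ∃ g : ℕ → Set α, g 0 = ∅ ∧ (∀ k, DifferAtMostOnce (g k) (g (k + 1))) ∧
      ∀ x y, g x = g y → x ≡ y [MOD 2 ^ Nat.card α] := by
  have := Fintype.ofFinite α
  obtain ⟨h, h0, -, hlast, hinj, hstep⟩ := exists_gray_path (Finset.univ : Finset α)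
  rw [Finset.card_univ, ← Nat.card_eq_fintype_card] at *
  have hpos : 0 < 2 ^ Nat.card α := by positivity
  set N := 2 ^ Nat.card α
  refine ⟨fun k => h (k % N), by simp [h0], fun k => ?_, fun x y hxy =>
    hinj (Nat.mod_lt _ hpos) (Nat.mod_lt _ hpos) hxy⟩
  have hk := Nat.mod_lt k hpos
  by_cases hlt : k % N + 1 < N
  · have h₁ : (k + 1) % N = k % N + 1 := by rw [← Nat.mod_add_mod, Nat.mod_eq_of_lt hlt]
    simp only [h₁]
    exact hstep _ hlt
  · have h₁ : k % N = N - 1 := by omega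
    have h₂ : (k + 1) % N = 0 := by
      rw [← Nat.mod_add_mod, h₁, Nat.sub_add_cancel hpos, Nat.mod_self]
    simp only [h₁, h₂, h0]
    exact hlast

/-! ### The specification -/

namespace MemorySpec

/-- The input signals: address bits, and three signals `query`, `value` and `side`. -/
abbrev Input (n : ℕ) : Type := Fin n ⊕ Fin 3

/-- The output signals `answer` and `echo`. -/
abbrev Output : Type := Bool

variable {n : ℕ}

/-- Marks the letter that asks for the stored value at its address. -/
abbrev query : Input n := Sum.inr 0

/-- The value that a letter writes at its address. -/
abbrev value : Input n := Sum.inr 1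

/-- A bit that the system repeats one step later. -/
abbrev side : Input n := Sum.inr 2

/-- The answer to a query. -/
abbrev answer : Output := true

/-- The value of `side` one step earlier. -/
abbrev echo : Output := false

/-- The address in a letter. -/
def address (ν : Set (Input n)) : Set (Fin n) := {i | Sum.inl i ∈ ν}

open Classical in
/-- The effect of a letter on the memory. -/
noncomputable def write (m : Set (Set (Fin n))) (ν : Set (Input n)) : Set (Set (Fin n)) :=
  if value ∈ ν then insert (address ν) m else m \ {address ν}

/-- The memory after the first `k` letters of an input word. -/
noncomputable def memory (w : ℕ → Set (Input n)) : ℕ → Set (Set (Fin n))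
  | 0 => ∅
  | k + 1 => write (memory w k) (w k)

theorem memory_congr {w w' : ℕ → Set (Input n)} {k : ℕ} (h : ∀ j < k, w j = w' j) :
    memory w k = memory w' k := by
  induction k with
  | zero => rfl
  | succ k ih => rw [memory, memory, ih fun j hj => h j (by omega), h k (by omega)]

/-- An address is stored if some letter writes it and no later letter erases it. -/
theorem mem_memory_iff {w : ℕ → Set (Input n)} {q : ℕ} {a : Set (Fin n)} :
    a ∈ memory w q ↔ ∃ k < q, address (w k) = a ∧ value ∈ w k ∧
      ∀ j, k ≤ j → j < q → address (w j) = a → value ∈ w j := by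
  induction q with
  | zero => simp [memory]
  | succ q ih =>
    rw [memory, write]
    by_cases ha : address (w q) = a
    · split_ifs with hv
      · simp only [ha, Set.mem_insert_iff, true_or, true_iff]
        refine ⟨q, by omega, ha, hv, fun j h₁ h₂ _ => ?_⟩
        rwa [show j = q by omega]
      · simp only [ha, Set.mem_sdiff, Set.mem_singleton_iff, not_true, and_false, false_iff]
        rintro ⟨k, hk, -, -, h⟩
        exact hv (h q (by omega) (by omega) ha)
    · refine Iff.trans (by split_ifs <;> simp [Ne.symm ha]) (ih.trans ⟨?_, ?_⟩)
      · rintro ⟨k, hk, h₁, h₂, h⟩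
        refine ⟨k, by omega, h₁, h₂, fun j h₃ h₄ h₅ => h j h₃ ?_ h₅⟩
        have : j ≠ q := by rintro rfl; exact ha h₅
        omega
      · rintro ⟨k, hk, h₁, h₂, h⟩
        have : k ≠ q := by rintro rfl; exact ha h₁
        exact ⟨k, by omega, h₁, h₂, fun j h₃ h₄ => h j h₃ (by omega)⟩

open LTL

/-- An input signal as a formula. -/
abbrev inp (x : Input n) : LTL (Input n ⊕ Output) := atom (Sum.inl x)

/-- An output signal as a formula. -/
abbrev outp (x : Output) : LTL (Input n ⊕ Output) := atom (Sum.inr x)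

/-- The `i`-th bit of the current address is that of the address at the query. -/
def bitMatch (i : Fin n) : LTL (Input n ⊕ Output) :=
  (inp (Sum.inl i)).iff (eventually ((inp query).and (inp (Sum.inl i))))

/-- The query is still to come and the current address is the address at the query. -/
def addressMatch (n : ℕ) : LTL (Input n ⊕ Output) :=
  (eventually (inp query)).and (conj ((List.finRange n).map bitMatch))

/-- There is exactly one query. -/
def uniqueQuery (n : ℕ) : LTL (Input n ⊕ Output) :=
  (eventually (inp query)).and (globally ((inp query).imp (next (globally (inp query).not))))

/-- The address at the query is stored when the query comes. -/
def stored (n : ℕ) : LTL (Input n ⊕ Output) :=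
  eventually ((addressMatch n).and ((inp query).not.and ((inp value).and
    -- The query letter matches its own address but writes only after the answer, hence the
    -- exemption.
    (globally ((addressMatch n).imp ((inp value).or (inp query)))))))

/-- The system repeats the side bit with delay one, and answers the query correctly if there is
exactly one. -/
def spec (n : ℕ) : LTL (Input n ⊕ Output) :=
  (globally ((inp side).iff (next (outp echo)))).and
    ((uniqueQuery n).imp ((stored n).iff (eventually ((inp query).and (outp answer)))))

/-! ### Fragment and size of the specification -/

theorem onlyXGF_addressMatch (n : ℕ) : (addressMatch n).OnlyXGF := by
  refine (OnlyXGF.atom _).eventually.and (.conj fun χ hχ => ?_)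
  obtain ⟨i, -, rfl⟩ := List.mem_map.1 hχ
  exact (OnlyXGF.atom _).iff ((OnlyXGF.atom _).and (.atom _)).eventually

theorem onlyXGF_spec (n : ℕ) : (spec n).OnlyXGF := by
  have hm := onlyXGF_addressMatch n
  have ha (x) : (atom x : LTL (Input n ⊕ Output)).OnlyXGF := .atom x
  refine OnlyXGF.and ((ha _).iff (ha _).next).globally (OnlyXGF.imp ?_ (OnlyXGF.iff ?_ ?_))
  · exact (ha _).eventually.and ((ha _).imp (ha _).not.globally.next).globally
  · exact (hm.and ((ha _).not.and ((ha _).and (hm.imp ((ha _).or (ha _))).globally))).eventually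
  · exact ((ha _).and (ha _)).eventually

theorem size_spec_le (n : ℕ) : (spec n).size ≤ 400 * n + 400 := by
  refine (size_le_length _).trans ?_
  -- `bitMatch i` has length 26, and each conjunction adds 4 nodes.
  have hconj : (conj ((List.finRange n).map bitMatch)).length ≤ (26 + 4) * n + 1 := by
    refine (length_conj_le (c := 26) fun χ hχ => ?_).trans (by simp)
    obtain ⟨i, -, rfl⟩ := List.mem_map.1 hχ
    simp [bitMatch, iff, LTL.and, imp, eventually, length]
  simp only [spec, stored, uniqueQuery, addressMatch, iff, LTL.and, imp, eventually, globally,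
    length]
  omega

theorem le_size_spec (n : ℕ) : n ≤ (spec n).size := by
  have hinj : Function.Injective fun i : Fin n => (inp (Sum.inl i) : LTL (Input n ⊕ Output)) :=
    fun i j h => by simpa using h
  have hsub : (Set.range fun i : Fin n => (inp (Sum.inl i) : LTL (Input n ⊕ Output))) ⊆
      (spec n).subformulas := by
    rintro _ ⟨i, rfl⟩
    have hi : inp (Sum.inl i) ∈ (conj ((List.finRange n).map bitMatch)).subformulas :=
      mem_subformulas_conj (χ := bitMatch i) (List.mem_map.2 ⟨i, List.mem_finRange i, rfl⟩)
        (by simp [bitMatch, iff, LTL.and, imp, subformulas])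
    have hm : inp (Sum.inl i) ∈ (addressMatch n).subformulas := by
      simp only [addressMatch, LTL.and, subformulas, Set.mem_insert_iff, Set.mem_union]
      tauto
    have hs : inp (Sum.inl i) ∈ (stored n).subformulas := by
      simp only [stored, eventually, LTL.and, subformulas, Set.mem_insert_iff, Set.mem_union]
      tauto
    simp only [spec, iff, imp, LTL.and, subformulas, Set.mem_insert_iff, Set.mem_union]
    tauto
  have := Set.ncard_le_ncard hsub (subformulas_finite _)
  rwa [← Set.image_univ, Set.ncard_image_of_injective _ hinj, Set.ncard_univ, Nat.card_fin] at this

/-! ### Semantics of the specification -/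

section Semantics

variable {M : MealyMachine (Input n) Output} {w : ℕ → Set (Input n)}

theorem sat_uniqueQuery :
    Sat (M.trace w) 0 (uniqueQuery n) ↔ ∃ q, ∀ k, query ∈ w k ↔ k = q := by
  simp only [uniqueQuery, sat_and, sat_eventually, sat_globally, sat_imp, sat_next, sat_not,
    sat_atom, M.inl_mem_trace, Nat.zero_le, true_and, true_imp_iff]
  constructor
  · rintro ⟨⟨q, hq⟩, h⟩
    refine ⟨q, fun k => ⟨fun hk => ?_, fun hk => hk ▸ hq⟩⟩
    rcases lt_trichotomy k q with hlt | heq | hlt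
    · exact absurd hq (h k hk q hlt)
    · exact heq
    · exact absurd hk (h q hq k hlt)
  · rintro ⟨q, hq⟩
    refine ⟨⟨q, (hq q).2 rfl⟩, fun m hm k hk hk' => ?_⟩
    have := (hq m).1 hm
    have := (hq k).1 hk'
    omega

/-- Up to position `q`, `F (query ∧ bit)` reads the bit at `q`. Beyond `q` the bit comparisons could
hold vacuously, which `F query` excludes. -/
theorem sat_addressMatch {q : ℕ} (hq : ∀ k, query ∈ w k ↔ k = q) (k : ℕ) :
    Sat (M.trace w) k (addressMatch n) ↔ k ≤ q ∧ address (w k) = address (w q) := by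
  have hF (P : ℕ → Prop) : (∃ m, k ≤ m ∧ m = q ∧ P m) ↔ k ≤ q ∧ P q :=
    ⟨fun ⟨m, h₁, h₂, h₃⟩ => h₂ ▸ ⟨h₁, h₃⟩, fun ⟨h₁, h₂⟩ => ⟨q, h₁, rfl, h₂⟩⟩
  simp only [addressMatch, sat_and, sat_eventually, sat_conj, List.mem_map, List.mem_finRange,
    true_and, forall_exists_index, forall_apply_eq_imp_iff, bitMatch, sat_iff, sat_atom,
    M.inl_mem_trace, hq, hF, exists_eq_right, Set.ext_iff, address, Set.mem_ofPred_eq]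
  exact and_congr_right fun h => by simp [h]

theorem sat_stored {q : ℕ} (hq : ∀ k, query ∈ w k ↔ k = q) :
    Sat (M.trace w) 0 (stored n) ↔ address (w q) ∈ memory w q := by
  simp only [stored, sat_and, sat_eventually, sat_globally, sat_imp, sat_not, sat_or, sat_atom,
    sat_addressMatch hq, M.inl_mem_trace, hq, mem_memory_iff, Nat.zero_le, true_and]
  refine exists_congr fun k => ⟨?_, ?_⟩
  · rintro ⟨⟨h₁, h₂⟩, h₃, h₄, h⟩
    exact ⟨by omega, h₂, h₄, fun j h₅ h₆ h₇ => (h j h₅ ⟨h₆.le, h₇⟩).resolve_right h₆.ne⟩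
  · rintro ⟨h₁, h₂, h₃, h⟩
    refine ⟨⟨h₁.le, h₂⟩, h₁.ne, h₃, fun j h₄ ⟨h₅, h₆⟩ => ?_⟩
    rcases h₅.lt_or_eq with hlt | heq
    · exact Or.inl (h j h₄ hlt h₆)
    · exact Or.inr heq

theorem sat_spec :
    Sat (M.trace w) 0 (spec n) ↔
      (∀ k, side ∈ w k ↔ echo ∈ M.out (M.run w (k + 1)) (w (k + 1))) ∧
      ∀ q, (∀ k, query ∈ w k ↔ k = q) →
        (address (w q) ∈ memory w q ↔ answer ∈ M.out (M.run w q) (w q)) := by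
  rw [spec, sat_and, sat_imp, sat_uniqueQuery]
  refine and_congr ?_ ?_
  · simp [sat_globally, sat_iff, sat_next, sat_atom, M.inl_mem_trace, M.inr_mem_trace]
  · rw [forall_exists_index]
    refine forall_congr' fun q => forall_congr' fun hq => ?_
    simp [sat_iff, sat_stored hq, sat_eventually, sat_and, sat_atom, M.inl_mem_trace,
      M.inr_mem_trace, hq]

end Semantics

/-- The machine that stores the memory and the last side bit. -/
noncomputable def memoryMachine (n : ℕ) : MealyMachine (Input n) Output where
  State := Set (Set (Fin n)) × Prop
  finite_state := inferInstance
  -- `False` is arbitrary: the first echo is unconstrained.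
  init := (∅, False)
  step s ν := (write s.1 ν, side ∈ ν)
  out s ν := {o | o = answer ∧ address ν ∈ s.1 ∨ o = echo ∧ s.2}

theorem run_memoryMachine (w : ℕ → Set (Input n)) (k : ℕ) :
    ((memoryMachine n).run w k).1 = memory w k := by
  induction k with
  | zero => rfl
  | succ k ih => rw [memory, ← ih]; rfl

theorem realizable_spec (n : ℕ) : (spec n).Realizable := by
  refine ⟨memoryMachine n, (MealyMachine.implements_iff _).2 fun w => sat_spec.2 ⟨fun k => ?_,
    fun q _ => ?_⟩⟩
  · simp [memoryMachine, MealyMachine.run]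
  · rw [← run_memoryMachine]
    simp [memoryMachine]

/-! ### Counting cycles -/

/-- In an implementation of the specification, a state that is reached without a query determines
the memory. -/
theorem memory_eq_of_run_eq {M : MealyMachine (Input n) Output} (hM : M.Implements (spec n))
    {w w' : ℕ → Set (Input n)} (hw : ∀ k, query ∉ w k) (hw' : ∀ k, query ∉ w' k) {k k' : ℕ}
    (h : M.run w k = M.run w' k') : memory w k = memory w' k' := by
  have key (w : ℕ → Set (Input n)) (hw : ∀ k, query ∉ w k) (k : ℕ) (a : Set (Fin n)) :
      a ∈ memory w k ↔ answer ∈ M.out (M.run w k) (insert query (Sum.inl '' a)) := by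
    -- Replaying `w` and then asking once for `a` forces an answer that depends only on the state
    -- and `a`.
    let u : ℕ → Set (Input n) := fun j =>
      if j < k then w j else if j = k then insert query (Sum.inl '' a) else ∅
    have hu : ∀ j < k, u j = w j := fun j hj => by simp [u, hj]
    have huk : u k = insert query (Sum.inl '' a) := by simp [u]
    have hq : ∀ j, query ∈ u j ↔ j = k := fun j => by
      rcases lt_trichotomy j k with hlt | rfl | hlt
      · simp [hu j hlt, hw, hlt.ne]
      · simp [huk]
      · simp [u, hlt.not_gt, hlt.ne']
    have ha : address (u k) = a := by ext; simp [huk, address]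
    have := (sat_spec.1 ((M.implements_iff).1 hM u)).2 k hq
    rwa [ha, huk, memory_congr hu, M.run_congr hu] at this
  ext a
  rw [key w hw, key w' hw', h]

/-- In an implementation of the specification, a state determines the side bit of the letter
before. -/
theorem side_iff_of_run_eq {M : MealyMachine (Input n) Output} (hM : M.Implements (spec n))
    {w w' : ℕ → Set (Input n)} {k k' : ℕ} (h : M.run w (k + 1) = M.run w' (k' + 1)) :
    side ∈ w k ↔ side ∈ w' k' := by
  have key (w : ℕ → Set (Input n)) (k : ℕ) :
      side ∈ w k ↔ echo ∈ M.out (M.run w (k + 1)) ∅ := by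
    -- The echo may depend on the next letter, so that letter is fixed as `∅`.
    let u : ℕ → Set (Input n) := fun j => if j < k + 1 then w j else ∅
    have hu : ∀ j < k + 1, u j = w j := fun j hj => if_pos hj
    have := (sat_spec.1 ((M.implements_iff).1 hM u)).1 k
    rwa [hu k (by omega), M.run_congr hu, show u (k + 1) = ∅ by simp [u]] at this
  rw [key, key w', h]

/-- There is an input word without queries for every Gray code and every choice of side bits. -/
theorem exists_word_of_gray_code {g : ℕ → Set (Set (Fin n))} (g0 : g 0 = ∅)
    (hg : ∀ k, DifferAtMostOnce (g k) (g (k + 1))) (β : ℕ → Prop) :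
    ∃ w : ℕ → Set (Input n), (∀ k, query ∉ w k) ∧ (∀ k, memory w k = g k) ∧
      ∀ k, side ∈ w k ↔ β k := by
  choose a ha using hg
  -- Letter `k` addresses the only point where `g` may change and writes its new value there.
  let w : ℕ → Set (Input n) := fun k =>
    {x | (∃ i ∈ a k, x = Sum.inl i) ∨ (x = value ∧ a k ∈ g (k + 1)) ∨ (x = side ∧ β k)}
  have haddr (k : ℕ) : address (w k) = a k := by ext; simp [w, address]
  refine ⟨w, fun k => by simp [w], fun k => ?_, fun k => by simp [w]⟩
  induction k with
  | zero => exact g0.symm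
  | succ k ih =>
    have hv : value ∈ w k ↔ a k ∈ g (k + 1) := by simp [w]
    rw [memory, write, ih, haddr]
    ext b
    by_cases hb : b = a k
    · subst hb
      split_ifs with h
      · simp [hv.1 h]
      · simp [mt hv.2 h]
    · split_ifs <;> simp [hb, ha k b hb]

theorem le_ncard_cycles {M : MealyMachine (Input n) Output} (hM : M.Implements (spec n)) :
    2 ^ 2 ^ 2 ^ n ≤ M.cycles.ncard := by
  obtain ⟨g, g0, hg, hmod⟩ := exists_gray_code (Set (Fin n))
  have hcard : Nat.card (Set (Fin n)) = 2 ^ n := by simp [Nat.card_eq_fintype_card]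
  rw [hcard] at hmod
  have hpos : 0 < 2 ^ 2 ^ n := by positivity
  set N := 2 ^ 2 ^ n
  have := M.finite_state
  choose w hquery hmem hside using fun β : Set (Fin N) =>
    exists_word_of_gray_code g0 hg fun k => (⟨k % N, Nat.mod_lt _ hpos⟩ : Fin N) ∈ β
  -- The shift by one gives each state of the walk a preceding letter, whose side bit it determines.
  choose c hc i d hd hret hC using fun β : Set (Fin N) =>
    exists_simpleCycle_of_walk (E := M.Edge) (f := fun k => M.run (w β) (k + 1))
      fun k => ⟨w β (k + 1), rfl⟩
  -- Returning to a state restores the memory, so the Gray period `N` divides `d β`.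
  have hN (β : Set (Fin N)) : N ≤ d β := by
    have h := memory_eq_of_run_eq hM (hquery β) (hquery β) (hret β)
    rw [hmem, hmem] at h
    have h' := (Nat.modEq_iff_dvd' (by omega)).1 (hmod _ _ h.symm)
    rw [show i β + d β + 1 - (i β + 1) = d β by omega] at h'
    exact Nat.le_of_dvd (hd β) h'
  have hinj : Function.Injective c := by
    intro β γ h
    ext t
    -- A segment of length at least `N` meets every residue. The state found there also lies on the
    -- cycle of `γ`, and it fixes both the residue and the side bit.
    obtain ⟨k, hk, hkt⟩ : ∃ k ∈ Set.Ico (i β) (i β + d β), k % N = t := by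
      have h₁ := hN β
      have h₂ := Nat.mod_lt (t + (N - i β % N)) hpos
      refine ⟨i β + (t + (N - i β % N)) % N, ⟨by omega, by omega⟩, ?_⟩
      have h₃ : i β + (t + (N - i β % N)) = t + N * (i β / N + 1) := by
        have := Nat.div_add_mod (i β) N
        have := Nat.mod_lt (i β) hpos
        rw [mul_add]
        omega
      rw [Nat.add_mod_mod, h₃, Nat.add_mul_mod_self_left, Nat.mod_eq_of_lt t.2]
    have hk' : M.run (w β) (k + 1) ∈ (c γ).1 := by
      rw [← h, hC β]
      exact ⟨k, hk, rfl⟩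
    rw [hC γ] at hk'
    obtain ⟨l, -, hl⟩ := hk'
    have h₁ := memory_eq_of_run_eq hM (hquery γ) (hquery β) hl
    rw [hmem, hmem] at h₁
    have h₂ : l % N = k % N := Nat.ModEq.add_right_cancel' 1 (hmod _ _ h₁)
    have h₃ := side_iff_of_run_eq hM hl
    rw [hside, hside] at h₃
    simp only [h₂, hkt] at h₃
    exact h₃.symm
  calc 2 ^ N = Nat.card (Set (Fin N)) := by simp [Nat.card_eq_fintype_card]
    _ = (Set.range c).ncard := by
      rw [← Set.image_univ, Set.ncard_image_of_injective _ hinj, Set.ncard_univ]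
    _ ≤ M.cycles.ncard :=
      Set.ncard_le_ncard (Set.range_subset_iff.2 hc) M.cycles_finite

end MemorySpec

theorem mainTheorem2 :
    ∃ (I O : ℕ → Type) (φ : (n : ℕ) → LTL (I n ⊕ O n)),
      (∀ n, Finite (I n) ∧ Finite (O n)) ∧
      Asymptotics.IsTheta Filter.atTop (fun n : ℕ => ((φ n).size : ℝ)) (fun n : ℕ => (n : ℝ)) ∧
      ∀ n : ℕ, 1 < n →
        (φ n).OnlyXGF ∧
        (φ n).Realizable ∧
        ∀ M : MealyMachine (I n) (O n), M.Implements (φ n) →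
          2 ^ 2 ^ 2 ^ n ≤ M.cycles.ncard := by
  refine ⟨MemorySpec.Input, fun _ => MemorySpec.Output, MemorySpec.spec,
    fun n => ⟨inferInstance, inferInstance⟩, ⟨?_, ?_⟩, fun n _ =>
    ⟨MemorySpec.onlyXGF_spec n, MemorySpec.realizable_spec n, fun M hM =>
      MemorySpec.le_ncard_cycles hM⟩⟩
  -- `400 * n + 400 ≤ 800 * n` once `n ≥ 1`.
  · refine Asymptotics.IsBigO.of_bound 800 ?_
    filter_upwards [Filter.eventually_ge_atTop 1] with n hn
    have := MemorySpec.size_spec_le n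
    rw [Real.norm_natCast, Real.norm_natCast]
    exact_mod_cast (by omega : (MemorySpec.spec n).size ≤ 800 * n)
  · refine Asymptotics.IsBigO.of_bound 1 (Filter.Eventually.of_forall fun n => ?_)
    rw [Real.norm_natCast, Real.norm_natCast, one_mul]
    exact_mod_cast MemorySpec.le_size_spec n
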